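/- Let $\mathrm{Aff}^+(\mathbb{R})$ be the Lie group of matrices $\begin{pmatrix} x & y\\ 0 & 1\end{pmatrix}$ with $x>0$, $y\in\mathbb{R}$, with global coordinates $(x,y)$, and let $\mathfrak{g}=\mathfrak{aff}(\mathbb{R})$ be its Lie algebra, with basis $e_1=\begin{pmatrix}1&0\\0&0\end{pmatrix}$, $e_2=\begin{pmatrix}0&1\\0&0\end{pmatrix}$, so $[e_1,e_2]=e_2$. A left-invariant metric $g$ means a left-invariant semi-Riemannian (nondegenerate, of any signature) metric, and $g_1$ denotes its value at the unit element, a nondegenerate symmetric bilinear form on $\mathfrak{g}$. The group $\mathrm{Aut}(\mathfrak{g})$ of Lie algebra automorphisms acts on symmetric bilinear forms by $(\varphi.b)(u,v)=b(\varphi^{-1}u,\varphi^{-1}v)$. Put $$g^{(-1)}=\frac{dx^2-dy^2}{x^2},\qquad g^{(0)}=\frac{dx\,dy+dy\,dx}{x^2}.$$ 1. A left-invariant metric $g$ on $\mathrm{Aff}^+(\mathbb{R})$ is geodesically complete (every maximal geodesic is defined on all of $\mathbb{R}$) if and only if it is positive definite or negative definite. 2. Up to multiplication by nonzero real constants, the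 Lorentzian left-invariant metrics on $\mathrm{Aff}^+(\mathbb{R})$ form exactly two $\mathrm{Aut}(\mathfrak{g})$-orbits, according to whether $e_2$ is isotropic or not. More precisely, the forms $g_1$ of the Lorentzian left-invariant metrics $g$ with $g_1(e_2,e_2)\neq 0$ are exactly the nonzero real multiples of the elements of the $\mathrm{Aut}(\mathfrak{g})$-orbit of $g^{(-1)}_1$, and the forms $g_1$ of the Lorentzian left-invariant metrics $g$ with $g_1(e_2,e_2)=0$ are exactly the elements of the $\mathrm{Aut}(\mathfrak{g})$-orbit of $g^{(0)}_1$. 3. Both $g^{(-1)}$ and $g^{(0)}$ are left-invariant, Lorentzian and geodesically incomplete: the curve $\gamma(t)=\left(\frac1{1-t},\frac1{1-t}\right)$, $t\in(-\infty,1)$, is a maximal geodesic of $g^{(-1)}$, and the curve $\gamma(t)=\left(\frac1{1-t},0\right)$, $t\in(-\infty,1)$, is a maximal geodesic of $g^{(0)}$. -/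

import Mathlib

open Set
open scoped Matrix ContDiff MatrixGroups

noncomputable section

attribute [local instance] LieRing.ofAssociativeRing

namespace AffLine

/-- The group `Aff⁺(ℝ)` of orientation preserving affine maps `s ↦ x s + y` of the line, as the
group of real matrices `(x y; 0 1)` with `x > 0`. -/
def AffPlus : Subgroup (GL (Fin 2) ℝ) where
  carrier := {A | 0 < A.1 0 0 ∧ A.1 1 0 = 0 ∧ A.1 1 1 = 1}
  one_mem' := by simp
  mul_mem' := by
    rintro A B ⟨h1, h2, h3⟩ ⟨k1, k2, k3⟩
    have hpos := mul_pos h1 k1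
    simp [Matrix.mul_apply, Fin.sum_univ_two, h2, h3, k2, k3] at *
    exact hpos
  inv_mem' := by
    rintro A ⟨h1, h2, h3⟩
    have hdet : A.1.det = A.1 0 0 := by rw [Matrix.det_fin_two, h2, h3]; ring
    have hne : A.1 0 0 ≠ 0 := h1.ne'
    simp only [mem_ofPred_eq, Matrix.coe_units_inv, Matrix.inv_def, hdet,
      Matrix.adjugate_fin_two, Ring.inverse_eq_inv', Matrix.smul_apply, Matrix.of_apply,
      Matrix.cons_val', Matrix.cons_val_zero, Matrix.cons_val_one, Matrix.cons_val_fin_one,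
      smul_eq_mul, h2, h3]
    refine ⟨by simpa using h1, by simp, inv_mul_cancel₀ hne⟩

/-- The Lie algebra `𝔞𝔣𝔣(ℝ)` of `Aff⁺(ℝ)`: the real matrices `(u v; 0 0)` with the commutator
bracket. -/
def aff : LieSubalgebra ℝ (Matrix (Fin 2) (Fin 2) ℝ) where
  carrier := {A | A 1 0 = 0 ∧ A 1 1 = 0}
  zero_mem' := by simp
  add_mem' := by
    rintro A B ⟨h1, h2⟩ ⟨k1, k2⟩
    simp [h1, h2, k1, k2]
  smul_mem' := by
    rintro c A ⟨h1, h2⟩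
    simp [h1, h2]
  lie_mem' := by
    rintro A B ⟨h1, h2⟩ ⟨k1, k2⟩
    simp [Ring.lie_def, Matrix.mul_apply, Fin.sum_univ_two, h1, h2, k1, k2]

/-- The basis `e₁ = (1 0; 0 0)`, `e₂ = (0 1; 0 0)` of `𝔞𝔣𝔣(ℝ)` (indexed by `0` and `1`). -/
def e : Fin 2 → aff :=
  ![⟨!![1, 0; 0, 0], by simp [aff, ← SetLike.mem_coe]⟩,
    ⟨!![0, 1; 0, 0], by simp [aff, ← SetLike.mem_coe]⟩]

/-- The global coordinates `(x, y)` of the matrix `(x y; 0 1)`. -/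
def coord (p : AffPlus) : Fin 2 → ℝ := fun i => p.1.1 0 i

/-- The image of the global chart: the half-plane `x > 0`. -/
def halfPlane : Set (Fin 2 → ℝ) := {q | 0 < q 0}

open Classical in
/-- The inverse of the global chart: `q = (x, y)` with `x > 0` is sent to the matrix `(x y; 0 1)`
(and, as a default value, the remaining `q` to the unit element). -/
def pt (q : Fin 2 → ℝ) : AffPlus :=
  if h : 0 < q 0 then
    ⟨Matrix.GeneralLinearGroup.mkOfDetNeZero !![q 0, q 1; 0, 1] (by simpa using h.ne'), by
      change _ ∧ _ ∧ _
      simpa [Matrix.GeneralLinearGroup.mkOfDetNeZero] using h⟩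
  else 1

/-!
`Aff⁺(ℝ)` is open in an affine plane of matrices whose direction is the vector space `aff`.
Hence every tangent space `T_p Aff⁺(ℝ)` is identified with `aff`: the tangent vector
`u ∂_x + v ∂_y` is the matrix `(u v; 0 0)`, that is, `∂_x` is `e 0` and `∂_y` is `e 1`.
-/

/-- The differential of the left translation `L_a : p ↦ a p`, as a map `T_p → T_{a p}`.
Since `L_a` is the restriction of a linear map of matrices, it is again `u ↦ a u`. -/
def dLeft (a : AffPlus) : aff →ₗ[ℝ] aff where
  toFun u := ⟨a.1.1 * u.1, by
    obtain ⟨-, h2, h3⟩ := a.2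
    obtain ⟨k1, k2⟩ := u.2
    change _ ∧ _
    simp [Matrix.mul_apply, Fin.sum_univ_two, h2, h3, k1, k2]⟩
  map_add' u v := by ext1; simp [mul_add]
  map_smul' c u := by ext1; simp

/-- The Gram matrix, in the frame `∂_x, ∂_y`, of a field of bilinear forms, as a function of the
coordinates. -/
def gram (g : AffPlus → LinearMap.BilinForm ℝ aff) (q : Fin 2 → ℝ) : Matrix (Fin 2) (Fin 2) ℝ :=
  Matrix.of fun i j => g (pt q) (e i) (e j)

/-- A semi-Riemannian metric on `Aff⁺(ℝ)`: a smooth field of nondegenerate symmetric bilinear forms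
on the tangent spaces. (The index is constant since `Aff⁺(ℝ)` is connected.) -/
structure SemiRiemannianMetric where
  toFun : AffPlus → LinearMap.BilinForm ℝ aff
  symm : ∀ p u v, toFun p u v = toFun p v u
  nondegenerate : ∀ p, (toFun p).Nondegenerate
  smooth : ∀ i j, ContDiffOn ℝ ∞ (fun q => gram toFun q i j) halfPlane

/-- A symmetric bilinear form on the plane `aff` is Lorentzian if it has signature `(1, 1)`, that is,
if it is diagonal in some basis with one negative and one positive entry. -/
def IsLorentzianForm (b : LinearMap.BilinForm ℝ aff) : Prop :=
  (∀ u v, b u v = b v u) ∧ ∃ u v, b u v = 0 ∧ b u u < 0 ∧ 0 < b v v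

/-- The orbit of `b` in the symmetric bilinear forms under the group `Aut(𝔤)` of Lie algebra
automorphisms, `φ` acting by `(φ.b)(u, v) = b(φ⁻¹ u, φ⁻¹ v)`. -/
def autOrbit (b : LinearMap.BilinForm ℝ aff) : Set (LinearMap.BilinForm ℝ aff) :=
  {b' | ∃ φ : aff ≃ₗ⁅ℝ⁆ aff, ∀ u v, b' u v = b (φ.symm u) (φ.symm v)}

/-- The nonzero real multiples of the elements of `autOrbit b`. -/
def scaledAutOrbit (b : LinearMap.BilinForm ℝ aff) : Set (LinearMap.BilinForm ℝ aff) :=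
  {b' | ∃ c : ℝ, c ≠ 0 ∧ ∃ b'' ∈ autOrbit b, b' = c • b''}

/-- The partial derivative `∂_i f` of a function of the coordinates. -/
def partialDeriv (i : Fin 2) (f : (Fin 2 → ℝ) → ℝ) (q : Fin 2 → ℝ) : ℝ :=
  fderiv ℝ f q (Pi.single i 1)

namespace SemiRiemannianMetric

variable (g : SemiRiemannianMetric)

/-- `g` is left-invariant if every left translation is an isometry. -/
def IsLeftInvariant : Prop :=
  ∀ a p u v, g.toFun (a * p) (dLeft a u) (dLeft a v) = g.toFun p u v

/-- The scalar product `g₁` on `𝔤 = T₁ Aff⁺(ℝ)`. -/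
def atOne : LinearMap.BilinForm ℝ aff := g.toFun 1

/-- `g` is definite: positive definite everywhere, or negative definite everywhere. -/
def IsDefinite : Prop :=
  (∀ p u, u ≠ 0 → 0 < g.toFun p u u) ∨ (∀ p u, u ≠ 0 → g.toFun p u u < 0)

def IsLorentzian : Prop := ∀ p, IsLorentzianForm (g.toFun p)

/-- The Christoffel symbols `Γ^k_{ij}` of the Levi-Civita connection of `g` in the global
coordinates. -/
def christoffel (k i j : Fin 2) (q : Fin 2 → ℝ) : ℝ :=
  (1 / 2) * ∑ l, (gram g.toFun q)⁻¹ k l *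
    (partialDeriv i (fun q' => gram g.toFun q' j l) q
      + partialDeriv j (fun q' => gram g.toFun q' i l) q
      - partialDeriv l (fun q' => gram g.toFun q' i j) q)

/-- `γ`, restricted to the nonempty open interval `I`, is a geodesic of `g`: a smooth curve with
`(γ^k)'' + ∑ Γ^k_{ij}(γ) (γ^i)' (γ^j)' = 0`. The values of `γ` outside `I` play no role. -/
def IsGeodesicOn (γ : ℝ → AffPlus) (I : Set ℝ) : Prop :=
  IsOpen I ∧ I.OrdConnected ∧ I.Nonempty ∧
  (∀ k, ContDiffOn ℝ ∞ (fun t => coord (γ t) k) I) ∧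
  ∀ t ∈ I, ∀ k, deriv (deriv fun s => coord (γ s) k) t +
    ∑ i, ∑ j, g.christoffel k i j (coord (γ t)) *
      deriv (fun s => coord (γ s) i) t * deriv (fun s => coord (γ s) j) t = 0

/-- `γ`, restricted to `I`, is a maximal (inextensible) geodesic: no geodesic on a strictly larger
interval extends it. -/
def IsMaximalGeodesicOn (γ : ℝ → AffPlus) (I : Set ℝ) : Prop :=
  g.IsGeodesicOn γ I ∧
  ∀ (δ : ℝ → AffPlus) (J : Set ℝ), g.IsGeodesicOn δ J → I ⊆ J → EqOn δ γ I → J = I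

/-- `g` is (geodesically) complete: every maximal geodesic is defined on the whole real line. -/
def IsComplete : Prop :=
  ∀ (γ : ℝ → AffPlus) (I : Set ℝ), g.IsMaximalGeodesicOn γ I → I = univ

end SemiRiemannianMetric

/-- The bilinear form `c₁ dx² + c₂ (dx dy + dy dx) + c₃ dy²` on `aff`. -/
def formOf (c₁ c₂ c₃ : ℝ) : LinearMap.BilinForm ℝ aff :=
  LinearMap.mk₂ ℝ
    (fun u v => c₁ * (u.1 0 0 * v.1 0 0) + c₂ * (u.1 0 0 * v.1 0 1 + u.1 0 1 * v.1 0 0)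
      + c₃ * (u.1 0 1 * v.1 0 1))
    (by intros; simp; ring) (by intros; simp; ring) (by intros; simp; ring) (by intros; simp; ring)

theorem pt_apply {q : Fin 2 → ℝ} (hq : 0 < q 0) : (pt q).1.1 = !![q 0, q 1; 0, 1] := by
  simp [pt, hq, Matrix.GeneralLinearGroup.mkOfDetNeZero]

theorem formOf_nondegenerate {c₁ c₂ c₃ : ℝ} (h : c₁ * c₃ - c₂ ^ 2 ≠ 0) {r : ℝ} (hr : r ≠ 0) :
    (r • formOf c₁ c₂ c₃).Nondegenerate := by
  have key : ∀ u : aff, (∀ v, (r • formOf c₁ c₂ c₃) u v = 0) → u = 0 := by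
    intro u hu
    have h0 := hu (e 0)
    have h1 := hu (e 1)
    simp [formOf, e, hr] at h0 h1
    have a0 : u.1 0 0 = 0 := by
      refine (mul_eq_zero.1 (?_ : (c₁ * c₃ - c₂ ^ 2) * u.1 0 0 = 0)).resolve_left h
      linear_combination c₃ * h0 - c₂ * h1
    have a1 : u.1 0 1 = 0 := by
      refine (mul_eq_zero.1 (?_ : (c₁ * c₃ - c₂ ^ 2) * u.1 0 1 = 0)).resolve_left h
      linear_combination c₁ * h1 - c₂ * h0
    obtain ⟨k1, k2⟩ := u.2
    ext i j
    fin_cases i <;> fin_cases j <;> simp_all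
  refine ⟨key, fun u hu => key u fun v => ?_⟩
  rw [← hu v]
  simp [formOf]
  left
  ring

/-- The metric `(1 / x²) (c₁ dx² + c₂ (dx dy + dy dx) + c₃ dy²)` on `Aff⁺(ℝ)`. -/
def stdMetric (c₁ c₂ c₃ : ℝ) (h : c₁ * c₃ - c₂ ^ 2 ≠ 0) : SemiRiemannianMetric where
  toFun p := (1 / coord p 0 ^ 2) • formOf c₁ c₂ c₃
  symm p u v := by simp [formOf]; left; ring
  nondegenerate p := formOf_nondegenerate h (by
    have : coord p 0 ≠ 0 := p.2.1.ne'
    positivity)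
  smooth i j := by
    have : ContDiffOn ℝ ∞ (fun q : Fin 2 → ℝ => 1 / q 0 ^ 2 * formOf c₁ c₂ c₃ (e i) (e j))
        halfPlane := by
      refine ContDiffOn.mul (ContDiffOn.div contDiffOn_const (by fun_prop) ?_) contDiffOn_const
      intro q hq
      have : q 0 ≠ 0 := ne_of_gt hq
      positivity
    refine this.congr fun q hq => ?_
    simp [gram, coord, pt_apply hq]

/-- The Lorentzian metric `g⁽⁻¹⁾ = (dx² - dy²) / x²`. -/
def gMinus : SemiRiemannianMetric := stdMetric 1 0 (-1) (by norm_num)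

/-- The Lorentzian metric `g⁽⁰⁾ = (dx dy + dy dx) / x²`. -/
def gZero : SemiRiemannianMetric := stdMetric 0 1 0 (by norm_num)

end AffLine

end

noncomputable section
attribute [local instance] LieRing.ofAssociativeRing

namespace AffLine

/-! The differential of the left translation by `a` is multiplication by the scalar `coord a 0`, so
a left-invariant metric is `1 / x ^ 2` times a constant form with coefficients `c₁, c₂, c₃`. The
sign of `D = c₁ * c₃ - c₂ ^ 2` separates definite from Lorentzian metrics.

If `D < 0`, some direction `(1, m)` is null, and the half-line `(1, m) / (1 - t)` is a geodesic that
blows up at `t = 1` (`isMaximalGeodesicOn_null`). If `D > 0`, translations in `y` give a conserved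
momentum `P`; with the conserved energy, normalized to `E`, they show that `u = 1 / x` solves the
linear equation `u'' = E u` with `u' ^ 2 = E u ^ 2 - P ^ 2 / D`. Because `P ^ 2 / D ≥ 0`, the
solution stays positive on the whole line, and `y` follows by a quadrature
(`exists_geodesic_extension`).

The orbits are computed from the explicit automorphisms `e₁ ↦ e₁ + s e₂`, `e₂ ↦ r e₂`
(`mem_autOrbit_formOf_iff`). -/

theorem aff_ext {u v : aff} (h0 : u.1 0 0 = v.1 0 0) (h1 : u.1 0 1 = v.1 0 1) : u = v := by
  obtain ⟨k1, k2⟩ := u.2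
  obtain ⟨l1, l2⟩ := v.2
  ext i j
  fin_cases i <;> fin_cases j <;> simp_all

@[simp] theorem e_zero_val : (e 0).1 = !![1, 0; 0, 0] := rfl

@[simp] theorem e_one_val : (e 1).1 = !![0, 1; 0, 0] := rfl

theorem eq_smul_e_add_smul_e (u : aff) : u = u.1 0 0 • e 0 + u.1 0 1 • e 1 := by
  apply aff_ext <;> simp

theorem coord_pos (p : AffPlus) : 0 < coord p 0 := p.2.1

theorem coord_pt {q : Fin 2 → ℝ} (hq : 0 < q 0) : coord (pt q) = q := by
  ext i
  fin_cases i <;> simp [coord, pt_apply hq]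

theorem coord_injective : Function.Injective coord := by
  intro p p' h
  have h0 : p.1.1 0 0 = p'.1.1 0 0 := congrFun h 0
  have h1 : p.1.1 0 1 = p'.1.1 0 1 := congrFun h 1
  obtain ⟨-, k1, k2⟩ := p.2
  obtain ⟨-, l1, l2⟩ := p'.2
  ext i j
  fin_cases i <;> fin_cases j <;> simp_all

theorem dLeft_apply_zero (a : AffPlus) (u : aff) :
    (dLeft a u).1 0 0 = coord a 0 * u.1 0 0 := by
  have := u.2.1
  simp [dLeft, coord, Matrix.mul_apply, Fin.sum_univ_two, this]

theorem dLeft_apply_one (a : AffPlus) (u : aff) :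
    (dLeft a u).1 0 1 = coord a 0 * u.1 0 1 := by
  have := u.2.2
  simp [dLeft, coord, Matrix.mul_apply, Fin.sum_univ_two, this]

theorem dLeft_eq_smul (a : AffPlus) (u : aff) : dLeft a u = coord a 0 • u := by
  apply aff_ext
  · simp [dLeft_apply_zero]
  · simp [dLeft_apply_one]

theorem coord_mul_zero (a p : AffPlus) : coord (a * p) 0 = coord a 0 * coord p 0 := by
  have := p.2.2.1
  simp [coord, Matrix.mul_apply, Fin.sum_univ_two, this]

@[simp] theorem coord_one_zero : coord 1 0 = 1 := by simp [coord]

/-! ### Constant forms and left-invariant metrics -/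

theorem formOf_apply (c₁ c₂ c₃ : ℝ) (u v : aff) :
    formOf c₁ c₂ c₃ u v = c₁ * (u.1 0 0 * v.1 0 0)
      + c₂ * (u.1 0 0 * v.1 0 1 + u.1 0 1 * v.1 0 0) + c₃ * (u.1 0 1 * v.1 0 1) := rfl

theorem eq_formOf {b : LinearMap.BilinForm ℝ aff} (hb : ∀ u v, b u v = b v u) :
    b = formOf (b (e 0) (e 0)) (b (e 0) (e 1)) (b (e 1) (e 1)) := by
  ext u v
  rw [formOf_apply]
  conv_lhs => rw [eq_smul_e_add_smul_e u, eq_smul_e_add_smul_e v]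
  simp only [map_add, map_smul, LinearMap.add_apply, LinearMap.smul_apply, smul_eq_mul]
  rw [hb (e 1) (e 0)]
  ring

theorem formOf_disc_ne_zero {c₁ c₂ c₃ : ℝ} (h : (formOf c₁ c₂ c₃).Nondegenerate) :
    c₁ * c₃ - c₂ ^ 2 ≠ 0 := by
  intro hD
  -- When `D = 0`, both `(c₃, -c₂)` and `(c₂, -c₁)` lie in the radical, hence vanish; then the form
  -- itself is zero.
  have h1 := h.1 (c₃ • e 0 - c₂ • e 1) fun v => by
    simp [formOf_apply]
    linear_combination v.1 0 0 * hD
  have h2 := h.1 (c₂ • e 0 - c₁ • e 1) fun v => by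
    simp [formOf_apply]
    linear_combination -v.1 0 1 * hD
  have a3 : c₃ = 0 := by simpa using congrArg (fun u : aff => u.1 0 0) h1
  have a2 : c₂ = 0 := by simpa using congrArg (fun u : aff => u.1 0 0) h2
  have a1 : c₁ = 0 := by simpa using congrArg (fun u : aff => u.1 0 1) h2
  have := h.1 (e 0) fun v => by simp [formOf_apply, a1, a2, a3]
  have := congrArg (fun u : aff => u.1 0 0) this
  simp at this

theorem stdMetric_toFun {c₁ c₂ c₃ : ℝ} (h : c₁ * c₃ - c₂ ^ 2 ≠ 0) (p : AffPlus) (u v : aff) :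
    (stdMetric c₁ c₂ c₃ h).toFun p u v = (1 / coord p 0 ^ 2) * formOf c₁ c₂ c₃ u v := rfl

theorem stdMetric_atOne {c₁ c₂ c₃ : ℝ} (h : c₁ * c₃ - c₂ ^ 2 ≠ 0) :
    (stdMetric c₁ c₂ c₃ h).atOne = formOf c₁ c₂ c₃ := by
  ext u v
  simp [SemiRiemannianMetric.atOne, stdMetric_toFun]

theorem stdMetric_isLeftInvariant {c₁ c₂ c₃ : ℝ} (h : c₁ * c₃ - c₂ ^ 2 ≠ 0) :
    (stdMetric c₁ c₂ c₃ h).IsLeftInvariant := by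
  intro a p u v
  have ha := (coord_pos a).ne'
  have hp := (coord_pos p).ne'
  simp only [stdMetric_toFun, dLeft_eq_smul, coord_mul_zero, map_smul, LinearMap.smul_apply,
    smul_eq_mul]
  field_simp

theorem SemiRiemannianMetric.toFun_injective :
    Function.Injective SemiRiemannianMetric.toFun := by
  rintro ⟨f, _, _, _⟩ ⟨f', _, _, _⟩ h
  cases h
  rfl

/-- The left-invariant metrics are exactly the metrics `stdMetric c₁ c₂ c₃`. -/
theorem SemiRiemannianMetric.IsLeftInvariant.exists_eq_stdMetric {g : SemiRiemannianMetric}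
    (hg : g.IsLeftInvariant) : ∃ c₁ c₂ c₃ h, g = stdMetric c₁ c₂ c₃ h := by
  have hb := eq_formOf (g.symm 1)
  have hD := formOf_disc_ne_zero (hb ▸ g.nondegenerate 1)
  refine ⟨_, _, _, hD, SemiRiemannianMetric.toFun_injective (funext fun p => ?_)⟩
  ext u v
  have hp := (coord_pos p).ne'
  rw [stdMetric_toFun, ← hb]
  have := hg p 1 u v
  rw [mul_one, dLeft_eq_smul, dLeft_eq_smul] at this
  simp only [map_smul, LinearMap.smul_apply, smul_eq_mul] at this
  rw [← this]
  field_simp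

/-! ### Signature and the sign of `D` -/

theorem isLorentzianForm_smul_formOf_iff {c₁ c₂ c₃ r : ℝ} (hr : 0 < r) :
    IsLorentzianForm (r • formOf c₁ c₂ c₃) ↔ c₁ * c₃ - c₂ ^ 2 < 0 := by
  constructor
  · rintro ⟨-, u, v, h1, h2, h3⟩
    simp only [LinearMap.smul_apply, smul_eq_mul, formOf_apply] at h1 h2 h3
    replace h1 := (mul_eq_zero.1 h1).resolve_left hr.ne'
    have h4 := (pos_iff_neg_of_mul_neg (a := r) h2).1 hr
    have h5 := (pos_iff_pos_of_mul_pos h3).1 hr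
    have h6 := mul_neg_of_neg_of_pos h4 h5
    by_contra! hD
    have h7 := mul_nonneg hD (sq_nonneg (u.1 0 0 * v.1 0 1 - u.1 0 1 * v.1 0 0))
    -- The Gram determinant of `u, v` is `D` times the square of their determinant.
    have h8 : (c₁ * c₃ - c₂ ^ 2) * (u.1 0 0 * v.1 0 1 - u.1 0 1 * v.1 0 0) ^ 2 =
      (c₁ * (u.1 0 0 * u.1 0 0) + c₂ * (u.1 0 0 * u.1 0 1 + u.1 0 1 * u.1 0 0) +
        c₃ * (u.1 0 1 * u.1 0 1)) *
      (c₁ * (v.1 0 0 * v.1 0 0) + c₂ * (v.1 0 0 * v.1 0 1 + v.1 0 1 * v.1 0 0) +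
        c₃ * (v.1 0 1 * v.1 0 1)) -
      (c₁ * (u.1 0 0 * v.1 0 0) + c₂ * (u.1 0 0 * v.1 0 1 + u.1 0 1 * v.1 0 0) +
        c₃ * (u.1 0 1 * v.1 0 1)) ^ 2 := by ring
    rw [h1] at h8
    linarith
  · intro hD
    refine ⟨fun u v => ?_, ?_⟩
    · simp only [LinearMap.smul_apply, smul_eq_mul, formOf_apply]
      ring
    suffices ∃ u v, formOf c₁ c₂ c₃ u v = 0 ∧ formOf c₁ c₂ c₃ u u < 0 ∧
        0 < formOf c₁ c₂ c₃ v v by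
      obtain ⟨u, v, h1, h2, h3⟩ := this
      refine ⟨u, v, ?_, ?_, ?_⟩ <;> simp only [LinearMap.smul_apply, smul_eq_mul]
      · rw [h1, mul_zero]
      · exact mul_neg_of_pos_of_neg hr h2
      · exact mul_pos hr h3
    -- `c₃ e₁ - c₂ e₂` is orthogonal to `e₂`, so these two vectors diagonalize the form when `c₃ ≠
    -- 0`.
    have hw : formOf c₁ c₂ c₃ (c₃ • e 0 - c₂ • e 1) (c₃ • e 0 - c₂ • e 1) =
        c₃ * (c₁ * c₃ - c₂ ^ 2) := by
      simp [formOf_apply]; ring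
    rcases lt_trichotomy c₃ 0 with h3 | h3 | h3
    · refine ⟨e 1, c₃ • e 0 - c₂ • e 1, ?_, ?_, ?_⟩
      · simp [formOf_apply]; ring
      · simpa [formOf_apply] using h3
      · rw [hw]; exact mul_pos_of_neg_of_neg h3 hD
    · have h2 : c₂ ≠ 0 := by rintro rfl; simp [h3] at hD
      -- Here `e₁ + m e₂` has square `c₁ + 2 c₂ m`; the two values of `m` make it `-1` and `1`.
      refine ⟨e 0 + ((-1 - c₁) / (2 * c₂)) • e 1, e 0 + ((1 - c₁) / (2 * c₂)) • e 1, ?_, ?_, ?_⟩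
      · simp [formOf_apply, h3]; field_simp; ring
      · simp only [formOf_apply, h3]; simp; field_simp; ring_nf; norm_num
      · simp only [formOf_apply, h3]; simp; field_simp; ring_nf; norm_num
    · refine ⟨c₃ • e 0 - c₂ • e 1, e 1, ?_, ?_, ?_⟩
      · simp [formOf_apply]; ring
      · rw [hw]; exact mul_neg_of_pos_of_neg h3 hD
      · simpa [formOf_apply] using h3

theorem stdMetric_isLorentzian_iff {c₁ c₂ c₃ : ℝ} (h : c₁ * c₃ - c₂ ^ 2 ≠ 0) :
    (stdMetric c₁ c₂ c₃ h).IsLorentzian ↔ c₁ * c₃ - c₂ ^ 2 < 0 := by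
  have key (p : AffPlus) : IsLorentzianForm ((stdMetric c₁ c₂ c₃ h).toFun p) ↔
      c₁ * c₃ - c₂ ^ 2 < 0 :=
    isLorentzianForm_smul_formOf_iff (by have := coord_pos p; positivity)
  exact ⟨fun hl => (key 1).1 (hl 1), fun hD p => (key p).2 hD⟩

theorem stdMetric_isDefinite_iff {c₁ c₂ c₃ : ℝ} (h : c₁ * c₃ - c₂ ^ 2 ≠ 0) :
    (stdMetric c₁ c₂ c₃ h).IsDefinite ↔ 0 < c₁ * c₃ - c₂ ^ 2 := by
  constructor
  · intro hd
    by_contra! hD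
    obtain ⟨-, u, v, -, hu, hv⟩ :=
      (stdMetric_isLorentzian_iff h).2 (lt_of_le_of_ne hD h) 1
    have hu0 : u ≠ 0 := by rintro rfl; simp at hu
    have hv0 : v ≠ 0 := by rintro rfl; simp at hv
    rcases hd with hd | hd
    · exact lt_asymm (hd 1 u hu0) hu
    · exact lt_asymm (hd 1 v hv0) hv
  · intro hD
    have h3 : c₃ ≠ 0 := by rintro rfl; nlinarith [sq_nonneg c₂]
    -- Completing the square shows that the form has the sign of `c₃`.
    have key (u : aff) (hu : u ≠ 0) : 0 < c₃ * formOf c₁ c₂ c₃ u u := by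
      have : c₃ * formOf c₁ c₂ c₃ u u =
          (c₁ * c₃ - c₂ ^ 2) * u.1 0 0 ^ 2 + (c₂ * u.1 0 0 + c₃ * u.1 0 1) ^ 2 := by
        rw [formOf_apply]; ring
      rw [this]
      by_cases h0 : u.1 0 0 = 0
      · have h1 : u.1 0 1 ≠ 0 := fun h1 => hu (aff_ext (by simpa using h0) (by simpa using h1))
        rw [h0]
        have : c₃ * u.1 0 1 ≠ 0 := mul_ne_zero h3 h1
        simp only [mul_zero, zero_add]
        positivity
      · positivity
    have hx (p : AffPlus) : 0 < 1 / coord p 0 ^ 2 := by have := coord_pos p; positivity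
    rcases lt_or_gt_of_ne h3 with h3 | h3
    · exact .inr fun p u hu => mul_neg_of_pos_of_neg (hx p)
        (neg_of_mul_pos_right (key u hu) h3.le)
    · exact .inl fun p u hu => mul_pos (hx p) (pos_of_mul_pos_right (key u hu) h3.le)

/-! ### Automorphisms and orbits -/

/-- In the basis `e`, the automorphisms of `𝔞𝔣𝔣(ℝ)` are `e₁ ↦ e₁ + s e₂`, `e₂ ↦ r e₂`. -/
theorem exists_aut_apply (φ : aff ≃ₗ⁅ℝ⁆ aff) : ∃ s r : ℝ, r ≠ 0 ∧
    ∀ u, φ u = u.1 0 0 • e 0 + (s * u.1 0 0 + r * u.1 0 1) • e 1 := by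
  have lie_e : ⁅e 0, e 1⁆ = e 1 := by
    apply aff_ext <;> simp [Ring.lie_def]
  have h := φ.map_lie (e 0) (e 1)
  rw [lie_e] at h
  have k1 := (φ (e 0)).2.1
  have k2 := (φ (e 0)).2.2
  have l1 := (φ (e 1)).2.1
  have l2 := (φ (e 1)).2.2
  -- Both coordinates of `[φ e₁, φ e₂] = φ e₂`: the first puts `φ e₂` on the line of `e₂`, the
  -- second then forces the `e₁`-coefficient of `φ e₁` to be `1`.
  have h0 := congrArg (fun u : aff => u.1 0 0) h
  have h1 := congrArg (fun u : aff => u.1 0 1) h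
  simp only [LieSubalgebra.coe_bracket, Ring.lie_def, Matrix.sub_apply, Matrix.mul_apply,
    Fin.sum_univ_two, k1, k2, l1, l2] at h0 h1
  have h0' : (φ (e 1)).1 0 0 = 0 := by linarith
  have hr : (φ (e 1)).1 0 1 ≠ 0 := by
    intro hr
    have : φ (e 1) = 0 := aff_ext (by simpa using h0') (by simpa using hr)
    have : e 1 = 0 := φ.injective (this.trans (map_zero φ).symm)
    simpa using congrArg (fun u : aff => u.1 0 1) this
  have hα : (φ (e 0)).1 0 0 = 1 := by
    rw [h0'] at h1
    exact mul_right_cancel₀ hr (by linarith)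
  refine ⟨(φ (e 0)).1 0 1, (φ (e 1)).1 0 1, hr, fun u => ?_⟩
  conv_lhs => rw [eq_smul_e_add_smul_e u, map_add, map_smul, map_smul]
  apply aff_ext <;> simp [h0', hα]
  ring

/-- The automorphism `e₁ ↦ e₁ + s e₂`, `e₂ ↦ r e₂` of `𝔞𝔣𝔣(ℝ)`. -/
def aut (s r : ℝ) (hr : r ≠ 0) : aff ≃ₗ⁅ℝ⁆ aff where
  toFun u := u.1 0 0 • e 0 + (s * u.1 0 0 + r * u.1 0 1) • e 1
  map_add' u v := by apply aff_ext <;> simp; ring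
  map_smul' c u := by apply aff_ext <;> simp; ring
  map_lie' {u v} := by
    have k1 := u.2.1
    have k2 := u.2.2
    have l1 := v.2.1
    have l2 := v.2.2
    apply aff_ext <;>
      simp [Ring.lie_def, Matrix.mul_apply, Fin.sum_univ_two, k1, k2, l1, l2] <;> ring
  invFun u := u.1 0 0 • e 0 + (r⁻¹ * (u.1 0 1 - s * u.1 0 0)) • e 1
  left_inv u := by apply aff_ext <;> simp; field_simp
  right_inv u := by apply aff_ext <;> simp; field_simp; ring

theorem aut_apply (s r : ℝ) (hr : r ≠ 0) (u : aff) :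
    aut s r hr u = u.1 0 0 • e 0 + (s * u.1 0 0 + r * u.1 0 1) • e 1 := rfl

theorem mem_autOrbit_formOf_iff {c₁ c₂ c₃ : ℝ} {b : LinearMap.BilinForm ℝ aff} :
    b ∈ autOrbit (formOf c₁ c₂ c₃) ↔ ∃ s r : ℝ, r ≠ 0 ∧
      b = formOf (c₁ + 2 * c₂ * s + c₃ * s ^ 2) (c₂ * r + c₃ * s * r) (c₃ * r ^ 2) := by
  constructor
  · rintro ⟨φ, hφ⟩
    obtain ⟨s, r, hr, h⟩ := exists_aut_apply φ.symm
    refine ⟨s, r, hr, ?_⟩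
    ext u v
    rw [hφ, h, h]
    simp [formOf_apply]
    ring
  · rintro ⟨s, r, hr, rfl⟩
    refine ⟨(aut s r hr).symm, fun u v => ?_⟩
    rw [LieEquiv.symm_symm, aut_apply, aut_apply]
    simp [formOf_apply]
    ring

theorem formOf_e_one (c₁ c₂ c₃ : ℝ) : formOf c₁ c₂ c₃ (e 1) (e 1) = c₃ := by
  simp [formOf_apply]

theorem setOf_lorentzian_eq_scaledAutOrbit :
    {b | ∃ g : SemiRiemannianMetric, g.IsLeftInvariant ∧ g.IsLorentzian ∧
        g.atOne (e 1) (e 1) ≠ 0 ∧ g.atOne = b} = scaledAutOrbit gMinus.atOne := by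
  ext b
  rw [gMinus, stdMetric_atOne]
  constructor
  · rintro ⟨g, hg, hl, h3, rfl⟩
    obtain ⟨c₁, c₂, c₃, h, rfl⟩ := hg.exists_eq_stdMetric
    rw [stdMetric_isLorentzian_iff] at hl
    rw [stdMetric_atOne, formOf_e_one] at h3
    rw [stdMetric_atOne]
    obtain ⟨D, hD⟩ : ∃ D, D = c₁ * c₃ - c₂ ^ 2 := ⟨_, rfl⟩
    rw [← hD] at hl
    obtain ⟨q, hq, hq2⟩ : ∃ q : ℝ, 0 < q ∧ D = -q ^ 2 :=
      ⟨√(-D), Real.sqrt_pos.2 (by linarith), by rw [Real.sq_sqrt (by linarith)]; ring⟩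
    -- A multiple `c` of an orbit element has `e₂`-square `-c r ^ 2` and determinant `-c ^ 2 r ^ 2`.
    -- Equating these to `c₃` and `D` gives `c = D / c₃` and `r = ± c₃ / q`; the mixed coefficient
    -- then gives `s`.
    refine ⟨D / c₃, div_ne_zero hl.ne h3, _,
      mem_autOrbit_formOf_iff.2 ⟨c₂ / q, c₃ / q, div_ne_zero h3 hq.ne', rfl⟩, ?_⟩
    have hc₁ : c₁ = (c₂ ^ 2 - q ^ 2) / c₃ := by
      field_simp
      linarith
    ext u v
    simp only [LinearMap.smul_apply, smul_eq_mul, formOf_apply, hq2, hc₁]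
    field_simp
    ring
  · rintro ⟨c, hc, b', hb', rfl⟩
    obtain ⟨s, r, hr, rfl⟩ := mem_autOrbit_formOf_iff.1 hb'
    have hD : c * (1 - s ^ 2) * (-c * r ^ 2) - (-c * s * r) ^ 2 < 0 := by
      have : 0 < (c * r) ^ 2 := by positivity
      linarith
    refine ⟨stdMetric _ _ _ hD.ne, stdMetric_isLeftInvariant _,
      (stdMetric_isLorentzian_iff _).2 hD, ?_, ?_⟩
    · rw [stdMetric_atOne, formOf_e_one]
      simp [hc, hr]
    · rw [stdMetric_atOne]
      ext u v
      simp only [LinearMap.smul_apply, smul_eq_mul, formOf_apply]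
      ring

theorem setOf_lorentzian_eq_autOrbit :
    {b | ∃ g : SemiRiemannianMetric, g.IsLeftInvariant ∧ g.IsLorentzian ∧
        g.atOne (e 1) (e 1) = 0 ∧ g.atOne = b} = autOrbit gZero.atOne := by
  ext b
  rw [gZero, stdMetric_atOne, mem_autOrbit_formOf_iff]
  constructor
  · rintro ⟨g, hg, hl, h3, rfl⟩
    obtain ⟨c₁, c₂, c₃, h, rfl⟩ := hg.exists_eq_stdMetric
    rw [stdMetric_atOne, formOf_e_one] at h3
    subst h3
    -- The orbit consists of the forms with coefficients `2 s, r, 0`; as `r` is any nonzero number,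
    -- no rescaling is needed.
    refine ⟨c₁ / 2, c₂, by rintro rfl; simp at h, ?_⟩
    rw [stdMetric_atOne]
    congr 1 <;> ring
  · rintro ⟨s, r, hr, rfl⟩
    have hD : 2 * s * 0 - r ^ 2 < 0 := by
      have : 0 < r ^ 2 := by positivity
      linarith
    refine ⟨stdMetric _ _ _ hD.ne, stdMetric_isLeftInvariant _,
      (stdMetric_isLorentzian_iff _).2 hD, ?_, ?_⟩
    · rw [stdMetric_atOne, formOf_e_one]
    · rw [stdMetric_atOne]
      congr 1 <;> ring

/-! ### Christoffel symbols and geodesic equations -/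

theorem gram_stdMetric {c₁ c₂ c₃ : ℝ} (h : c₁ * c₃ - c₂ ^ 2 ≠ 0) {q : Fin 2 → ℝ} (hq : 0 < q 0) :
    gram (stdMetric c₁ c₂ c₃ h).toFun q = (1 / q 0 ^ 2) • !![c₁, c₂; c₂, c₃] := by
  ext i j
  fin_cases i <;> fin_cases j <;> simp [gram, stdMetric_toFun, coord_pt hq, formOf_apply]

theorem gram_stdMetric_inv {c₁ c₂ c₃ : ℝ} (h : c₁ * c₃ - c₂ ^ 2 ≠ 0) {q : Fin 2 → ℝ}
    (hq : 0 < q 0) : (gram (stdMetric c₁ c₂ c₃ h).toFun q)⁻¹ =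
      (q 0 ^ 2 / (c₁ * c₃ - c₂ ^ 2)) • !![c₃, -c₂; -c₂, c₁] := by
  have hq' := hq.ne'
  apply Matrix.inv_eq_right_inv
  rw [gram_stdMetric h hq]
  ext i j
  fin_cases i <;> fin_cases j <;> simp [Matrix.mul_apply, Fin.sum_univ_two] <;> field_simp <;> ring

theorem partialDeriv_gram_stdMetric {c₁ c₂ c₃ : ℝ} (h : c₁ * c₃ - c₂ ^ 2 ≠ 0) {q : Fin 2 → ℝ}
    (hq : 0 < q 0) (l i j : Fin 2) :
    partialDeriv l (fun q' => gram (stdMetric c₁ c₂ c₃ h).toFun q' i j) q =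
      -2 / q 0 ^ 3 * !![c₁, c₂; c₂, c₃] i j * Pi.single (M := fun _ => ℝ) l 1 0 := by
  -- The rational formula holds only on the half-plane, since `pt` has a default value elsewhere; a
  -- neighbourhood of `q` suffices for the derivative.
  have hev : (fun q' => gram (stdMetric c₁ c₂ c₃ h).toFun q' i j) =ᶠ[nhds q]
      fun q' => (q' 0 ^ 2)⁻¹ * !![c₁, c₂; c₂, c₃] i j := by
    filter_upwards [(continuous_apply (0 : Fin 2)).continuousAt.eventually (lt_mem_nhds hq)]
      with q' hq'
    simp [gram_stdMetric h hq']
  have hd : HasFDerivAt (fun q' : Fin 2 → ℝ => (q' 0 ^ 2)⁻¹ * !![c₁, c₂; c₂, c₃] i j)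
      ((-2 / q 0 ^ 3 * !![c₁, c₂; c₂, c₃] i j) •
        (ContinuousLinearMap.proj 0 : (Fin 2 → ℝ) →L[ℝ] ℝ)) q := by
    have h1 : HasDerivAt (fun x : ℝ => (x ^ 2)⁻¹ * !![c₁, c₂; c₂, c₃] i j)
        (-2 / q 0 ^ 3 * !![c₁, c₂; c₂, c₃] i j) (q 0) := by
      refine (((hasDerivAt_pow 2 (q 0)).inv (pow_ne_zero 2 hq.ne')).mul_const
        (!![c₁, c₂; c₂, c₃] i j)).congr_deriv ?_
      have := hq.ne'
      field_simp
      norm_num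
      ring
    exact h1.comp_hasFDerivAt (f := fun q' : Fin 2 → ℝ => q' 0) q (hasFDerivAt_apply (𝕜 := ℝ) 0 q)
  rw [partialDeriv, hev.fderiv_eq, hd.fderiv]
  simp

theorem sum_christoffel_zero {c₁ c₂ c₃ : ℝ} (h : c₁ * c₃ - c₂ ^ 2 ≠ 0) {q : Fin 2 → ℝ}
    (hq : 0 < q 0) (v : Fin 2 → ℝ) :
    ∑ i, ∑ j, (stdMetric c₁ c₂ c₃ h).christoffel 0 i j q * v i * v j =
      (c₃ * (c₁ * v 0 ^ 2 + 2 * c₂ * v 0 * v 1 + c₃ * v 1 ^ 2) / (c₁ * c₃ - c₂ ^ 2)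
        - 2 * v 0 ^ 2) / q 0 := by
  have hq' := hq.ne'
  simp only [SemiRiemannianMetric.christoffel, gram_stdMetric_inv h hq,
    partialDeriv_gram_stdMetric h hq, Fin.sum_univ_two]
  simp
  field_simp
  ring

theorem sum_christoffel_one {c₁ c₂ c₃ : ℝ} (h : c₁ * c₃ - c₂ ^ 2 ≠ 0) {q : Fin 2 → ℝ}
    (hq : 0 < q 0) (v : Fin 2 → ℝ) :
    ∑ i, ∑ j, (stdMetric c₁ c₂ c₃ h).christoffel 1 i j q * v i * v j =
      (-c₂ * (c₁ * v 0 ^ 2 + 2 * c₂ * v 0 * v 1 + c₃ * v 1 ^ 2) / (c₁ * c₃ - c₂ ^ 2)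
        - 2 * v 0 * v 1) / q 0 := by
  have hq' := hq.ne'
  simp only [SemiRiemannianMetric.christoffel, gram_stdMetric_inv h hq,
    partialDeriv_gram_stdMetric h hq, Fin.sum_univ_two]
  simp
  field_simp
  ring

/-- The geodesic equations of `stdMetric c₁ c₂ c₃` at a point of the half-plane with first
coordinate `x`, for the velocity `(x', y')` and the acceleration `(x'', y'')`. -/
def GeodesicEq (c₁ c₂ c₃ x x' y' x'' y'' : ℝ) : Prop :=
  x * x'' = 2 * x' ^ 2
    - c₃ * (c₁ * x' ^ 2 + 2 * c₂ * x' * y' + c₃ * y' ^ 2) / (c₁ * c₃ - c₂ ^ 2) ∧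
  x * y'' = 2 * x' * y'
    + c₂ * (c₁ * x' ^ 2 + 2 * c₂ * x' * y' + c₃ * y' ^ 2) / (c₁ * c₃ - c₂ ^ 2)

theorem forall_christoffel_iff {c₁ c₂ c₃ : ℝ} (h : c₁ * c₃ - c₂ ^ 2 ≠ 0) {q : Fin 2 → ℝ}
    (hq : 0 < q 0) (v w : Fin 2 → ℝ) :
    (∀ k, w k + ∑ i, ∑ j, (stdMetric c₁ c₂ c₃ h).christoffel k i j q * v i * v j = 0) ↔
      GeodesicEq c₁ c₂ c₃ (q 0) (v 0) (v 1) (w 0) (w 1) := by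
  have hq' := hq.ne'
  rw [Fin.forall_fin_two, sum_christoffel_zero h hq, sum_christoffel_one h hq, GeodesicEq]
  refine and_congr ?_ ?_
  · rw [add_div' _ _ _ hq', div_eq_zero_iff, or_iff_left hq']
    constructor <;> intro h <;> linear_combination h
  · rw [add_div' _ _ _ hq', div_eq_zero_iff, or_iff_left hq', neg_mul, neg_div]
    constructor <;> intro h <;> linear_combination h

theorem isGeodesicOn_of_hasDerivAt {c₁ c₂ c₃ : ℝ} (h : c₁ * c₃ - c₂ ^ 2 ≠ 0) {I : Set ℝ}
    (hI : IsOpen I) (hI' : I.OrdConnected) (hI'' : I.Nonempty) {x y x' y' x'' y'' : ℝ → ℝ}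
    (hx : ContDiffOn ℝ ∞ x I) (hy : ContDiffOn ℝ ∞ y I) (hpos : ∀ t ∈ I, 0 < x t)
    (hx' : ∀ t ∈ I, HasDerivAt x (x' t) t) (hx'' : ∀ t ∈ I, HasDerivAt x' (x'' t) t)
    (hy' : ∀ t ∈ I, HasDerivAt y (y' t) t) (hy'' : ∀ t ∈ I, HasDerivAt y' (y'' t) t)
    (heq : ∀ t ∈ I, GeodesicEq c₁ c₂ c₃ (x t) (x' t) (y' t) (x'' t) (y'' t)) :
    (stdMetric c₁ c₂ c₃ h).IsGeodesicOn (fun t => pt ![x t, y t]) I := by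
  have hc (k : Fin 2) : EqOn (fun t => coord (pt ![x t, y t]) k) (![x, y] k) I := by
    intro t ht
    simp only [coord_pt (q := ![x t, y t]) (hpos t ht)]
    fin_cases k <;> rfl
  have hd1 (k : Fin 2) : EqOn (deriv fun t => coord (pt ![x t, y t]) k) (![x', y'] k) I := by
    intro t ht
    rw [((hc k).eventuallyEq_of_mem (hI.mem_nhds ht)).deriv_eq]
    fin_cases k
    exacts [(hx' t ht).deriv, (hy' t ht).deriv]
  have hd2 (k : Fin 2) :
      EqOn (deriv (deriv fun t => coord (pt ![x t, y t]) k)) (![x'', y''] k) I := by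
    intro t ht
    rw [((hd1 k).eventuallyEq_of_mem (hI.mem_nhds ht)).deriv_eq]
    fin_cases k
    exacts [(hx'' t ht).deriv, (hy'' t ht).deriv]
  refine ⟨hI, hI', hI'', fun k => ?_, fun t ht => ?_⟩
  · refine ContDiffOn.congr ?_ (hc k)
    fin_cases k
    exacts [hx, hy]
  · refine (forall_christoffel_iff h (coord_pos _)
      (fun i => deriv (fun s => coord (pt ![x s, y s]) i) t)
      (fun k => deriv (deriv fun s => coord (pt ![x s, y s]) k) t)).2 ?_
    have h0 : coord (pt ![x t, y t]) 0 = x t := hc 0 ht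
    simp only [hd1 _ ht, hd2 _ ht, h0]
    exact heq t ht

/-! ### Null geodesics and incompleteness -/

/-- The null geodesics of the indefinite left-invariant metrics in the direction `(1, m)`. -/
theorem isMaximalGeodesicOn_null {c₁ c₂ c₃ m : ℝ} (h : c₁ * c₃ - c₂ ^ 2 ≠ 0)
    (hm : c₁ + 2 * c₂ * m + c₃ * m ^ 2 = 0) :
    (stdMetric c₁ c₂ c₃ h).IsMaximalGeodesicOn
      (fun t => pt ![1 / (1 - t), m / (1 - t)]) (Iio 1) := by
  have hne (t : ℝ) (ht : t ∈ Iio (1 : ℝ)) : 1 - t ≠ 0 := (sub_pos.2 ht).ne'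
  constructor
  · have hd0 (t : ℝ) : HasDerivAt (fun s : ℝ => 1 - s) (-1) t := by
      simpa using (hasDerivAt_id t).const_sub 1
    have hd1 (a t : ℝ) (ht : t ∈ Iio (1 : ℝ)) :
        HasDerivAt (fun t => a / (1 - t)) (a / (1 - t) ^ 2) t := by
      refine ((hasDerivAt_const t a).div (hd0 t) (hne t ht)).congr_deriv ?_
      simp
    have hd2 (a t : ℝ) (ht : t ∈ Iio (1 : ℝ)) :
        HasDerivAt (fun t => a / (1 - t) ^ 2) (2 * a / (1 - t) ^ 3) t := by
      refine ((hasDerivAt_const t a).div ((hd0 t).pow 2) (pow_ne_zero 2 (hne t ht))).congr_deriv ?_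
      have := hne t ht
      simp
      field_simp
    have hs (a : ℝ) : ContDiffOn ℝ ∞ (fun t => a / (1 - t)) (Iio 1) :=
      contDiffOn_const.div (by fun_prop) hne
    refine isGeodesicOn_of_hasDerivAt h isOpen_Iio ordConnected_Iio nonempty_Iio (hs 1) (hs m)
      (fun t ht => by have : 0 < 1 - t := sub_pos.2 (mem_Iio.1 ht); positivity)
      (hd1 1) (hd2 1) (hd1 m) (hd2 m) fun t ht => ?_
    -- The velocity is null, so the metric term drops out, leaving `x x'' = 2 x' ^ 2` and `x y'' = 2
    -- x' y'`.
    have hN : c₁ * (1 / (1 - t) ^ 2) ^ 2 + 2 * c₂ * (1 / (1 - t) ^ 2) * (m / (1 - t) ^ 2)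
        + c₃ * (m / (1 - t) ^ 2) ^ 2 = 0 := by
      linear_combination (1 / (1 - t) ^ 2) ^ 2 * hm
    have := hne t ht
    rw [GeodesicEq, hN]
    constructor <;> field_simp <;> ring
  · rintro δ J ⟨hJ, hJ', -, hs, -⟩ hsub heq
    refine (hsub.antisymm fun t ht => ?_).symm
    by_contra ht1
    -- A larger interval contains `1`, where the first coordinate would be continuous, yet it tends
    -- to infinity from the left.
    have h1 : (1 : ℝ) ∈ J := hJ'.out (hsub (by simp : (0 : ℝ) ∈ Iio (1 : ℝ))) ht
      ⟨zero_le_one, not_lt.1 ht1⟩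
    have hcont : Filter.Tendsto (fun t => coord (δ t) 0) (nhdsWithin 1 (Iio 1))
        (nhds (coord (δ 1) 0)) :=
      ((hs 0).continuousOn.continuousAt (hJ.mem_nhds h1)).mono_left nhdsWithin_le_nhds
    refine not_tendsto_nhds_of_tendsto_atTop ?_ _ hcont
    have hlim : Filter.Tendsto (fun t : ℝ => 1 - t) (nhdsWithin 1 (Iio 1))
        (nhdsWithin 0 (Ioi 0)) := by
      refine tendsto_nhdsWithin_iff.2 ⟨?_, ?_⟩
      · refine Filter.Tendsto.mono_left ?_ nhdsWithin_le_nhds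
        exact (by fun_prop : Continuous fun t : ℝ => 1 - t).tendsto' 1 0 (sub_self 1)
      · exact eventually_nhdsWithin_of_forall fun t ht => mem_Ioi.2 (sub_pos.2 (mem_Iio.1 ht))
    refine (tendsto_inv_nhdsGT_zero.comp hlim).congr' ?_
    refine eventually_nhdsWithin_of_forall fun t ht => ?_
    have hpos : 0 < (![1 / (1 - t), m / (1 - t)] : Fin 2 → ℝ) 0 := by
      simpa using ht
    simp only [heq ht, coord_pt hpos]
    simp

theorem not_isComplete_of_disc_neg {c₁ c₂ c₃ : ℝ} (h : c₁ * c₃ - c₂ ^ 2 ≠ 0)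
    (hD : c₁ * c₃ - c₂ ^ 2 < 0) : ¬ (stdMetric c₁ c₂ c₃ h).IsComplete := by
  obtain ⟨m, hm⟩ : ∃ m, c₁ + 2 * c₂ * m + c₃ * m ^ 2 = 0 := by
    by_cases h3 : c₃ = 0
    · have h2 : c₂ ≠ 0 := by rintro rfl; simp [h3] at hD
      exact ⟨-c₁ / (2 * c₂), by rw [h3]; field_simp; ring⟩
    · refine ⟨(-c₂ + √(c₂ ^ 2 - c₁ * c₃)) / c₃, ?_⟩
      have := Real.sq_sqrt (by linarith : 0 ≤ c₂ ^ 2 - c₁ * c₃)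
      field_simp
      linear_combination this
  intro hc
  have := hc _ _ (isMaximalGeodesicOn_null h hm)
  exact lt_irrefl (1 : ℝ) (mem_Iio.1 (this ▸ mem_univ 1))

/-! ### Completeness in the definite case -/

theorem eq_of_hasDerivAt_zero {I : Set ℝ} (hI : IsOpen I) (hI' : I.OrdConnected) {f : ℝ → ℝ}
    (hf : ∀ t ∈ I, HasDerivAt f 0 t) {s t : ℝ} (hs : s ∈ I) (ht : t ∈ I) : f s = f t :=
  hI.is_const_of_deriv_eq_zero hI'.isPreconnected
    (fun r hr => (hf r hr).differentiableAt.differentiableWithinAt)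
    (fun r hr => (hf r hr).deriv) hs ht

theorem exists_eq_of_hasDerivAt_zero {I : Set ℝ} (hI : IsOpen I) (hI' : I.OrdConnected)
    (hI'' : I.Nonempty) {f : ℝ → ℝ} (hf : ∀ t ∈ I, HasDerivAt f 0 t) : ∃ a, ∀ t ∈ I, f t = a :=
  hI''.elim fun _ ht₀ => ⟨_, fun _ ht => eq_of_hasDerivAt_zero hI hI' hf ht ht₀⟩

/-- A positive solution of `u'' = E u` on an interval with `u'² = E u² - F`, `0 ≤ F`, extends to a
positive solution on the line. -/
theorem exists_extension_of_linear_ode {I : Set ℝ} (hI : IsOpen I) (hI' : I.OrdConnected)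
    (hI'' : I.Nonempty) {u v : ℝ → ℝ} {E F : ℝ} (hu : ∀ t ∈ I, HasDerivAt u (v t) t)
    (hv : ∀ t ∈ I, HasDerivAt v (E * u t) t) (hpos : ∀ t ∈ I, 0 < u t)
    (hF : 0 ≤ F) (huv : ∀ t ∈ I, v t ^ 2 = E * u t ^ 2 - F) :
    ∃ U V : ℝ → ℝ, ContDiff ℝ ∞ U ∧ (∀ t, HasDerivAt U (V t) t) ∧
      (∀ t, HasDerivAt V (E * U t) t) ∧ (∀ t, 0 < U t) ∧ (∀ t, V t ^ 2 = E * U t ^ 2 - F) ∧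
      EqOn u U I := by
  obtain ⟨t₀, ht₀⟩ := hI''
  have hu0 := hpos t₀ ht₀
  have hE : 0 ≤ E := by
    by_contra! hE
    have := mul_neg_of_neg_of_pos hE (pow_pos hu0 2)
    nlinarith [huv t₀ ht₀, sq_nonneg (v t₀)]
  rcases hE.eq_or_lt with rfl | hE
  · have hF0 : F = 0 := by nlinarith [huv t₀ ht₀, sq_nonneg (v t₀)]
    have hv0 : ∀ t ∈ I, v t = 0 := fun t ht => by simpa [hF0] using huv t ht
    refine ⟨fun _ => u t₀, fun _ => 0, contDiff_const, fun t => hasDerivAt_const _ _,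
      fun t => by simpa using hasDerivAt_const t (0 : ℝ), fun _ => hu0, fun _ => by simp [hF0],
      fun t ht => eq_of_hasDerivAt_zero hI hI' (fun s hs => hv0 s hs ▸ hu s hs) ht ht₀⟩
  obtain ⟨w, hw, rfl⟩ : ∃ w : ℝ, 0 < w ∧ E = w ^ 2 :=
    ⟨√E, Real.sqrt_pos.2 hE, (Real.sq_sqrt hE.le).symm⟩
  have hexp (c t : ℝ) : HasDerivAt (fun s => Real.exp (c * s)) (c * Real.exp (c * t)) t := by
    simpa [mul_comm] using ((hasDerivAt_id t).const_mul c).exp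
  have hinv (t : ℝ) : Real.exp (w * t) * Real.exp (-w * t) = 1 := by
    rw [← Real.exp_add]; simp
  -- The coefficients `a, b` of `exp (w t)` and `exp (-w t)` in `u` are first integrals, so no
  -- uniqueness theorem for differential equations is needed.
  obtain ⟨a, ha⟩ : ∃ a, ∀ t ∈ I, (u t + v t / w) / 2 * Real.exp (-w * t) = a := by
    refine exists_eq_of_hasDerivAt_zero hI hI' ⟨t₀, ht₀⟩ fun s hs => ?_
    refine ((((hu s hs).add ((hv s hs).div_const w)).div_const 2).mul (hexp (-w) s)).congr_deriv ?_
    simp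
    field_simp
    ring
  obtain ⟨b, hb⟩ : ∃ b, ∀ t ∈ I, (u t - v t / w) / 2 * Real.exp (w * t) = b := by
    refine exists_eq_of_hasDerivAt_zero hI hI' ⟨t₀, ht₀⟩ fun s hs => ?_
    refine ((((hu s hs).sub ((hv s hs).div_const w)).div_const 2).mul (hexp w s)).congr_deriv ?_
    simp
    field_simp
    ring
  have hU : ∀ t ∈ I, u t = a * Real.exp (w * t) + b * Real.exp (-w * t) := fun t ht => by
    rw [← ha t ht, ← hb t ht]
    linear_combination (-u t) * hinv t
  -- As `F ≥ 0`, `a` and `b` cannot have opposite signs; positivity of `u` at one point then makes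
  -- both nonnegative and not both zero.
  have hab : 4 * a * b * w ^ 2 = F := by
    have h1 := huv t₀ ht₀
    have h2 := hinv t₀
    rw [← ha t₀ ht₀, ← hb t₀ ht₀]
    have : 4 * ((u t₀ + v t₀ / w) / 2 * Real.exp (-w * t₀)) *
        ((u t₀ - v t₀ / w) / 2 * Real.exp (w * t₀)) * w ^ 2 =
        (w ^ 2 * u t₀ ^ 2 - v t₀ ^ 2) * (Real.exp (w * t₀) * Real.exp (-w * t₀)) := by
      field_simp
      ring
    rw [this, h2, h1]
    ring
  have hab0 : 0 ≤ a * b := by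
    by_contra! hneg
    have := mul_neg_of_neg_of_pos hneg (pow_pos hw 2)
    linarith
  have h0 := hU t₀ ht₀ ▸ hu0
  have e1 (t : ℝ) := Real.exp_pos (w * t)
  have e2 (t : ℝ) := Real.exp_pos (-w * t)
  have ha0 : 0 ≤ a := by
    by_contra! hneg
    have := nonpos_of_mul_nonneg_right hab0 hneg
    nlinarith [mul_neg_of_neg_of_pos hneg (e1 t₀), mul_nonneg (neg_nonneg.2 this) (e2 t₀).le]
  have hb0 : 0 ≤ b := by
    by_contra! hneg
    have := nonpos_of_mul_nonneg_left hab0 hneg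
    nlinarith [mul_neg_of_neg_of_pos hneg (e2 t₀), mul_nonneg (neg_nonneg.2 this) (e1 t₀).le]
  refine ⟨fun t => a * Real.exp (w * t) + b * Real.exp (-w * t),
    fun t => a * (w * Real.exp (w * t)) + b * (-w * Real.exp (-w * t)), by fun_prop,
    fun t => ((hexp w t).const_mul a).add ((hexp (-w) t).const_mul b), fun t => ?_, fun t => ?_,
    fun t => ?_, hU⟩
  · refine ((((hexp w t).const_mul w).const_mul a).add
      (((hexp (-w) t).const_mul (-w)).const_mul b)).congr_deriv ?_
    ring
  · rcases ha0.eq_or_lt with rfl | ha0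
    · rcases hb0.eq_or_lt with rfl | hb0
      · simp at h0
      · have := e2 t
        simp only [zero_mul, zero_add]
        positivity
    · have := mul_pos ha0 (e1 t)
      have := mul_nonneg hb0 (e2 t).le
      linarith
  · linear_combination (-4 * a * b * w ^ 2) * hinv t - hab

theorem exists_geodesic_extension {c₁ c₂ c₃ : ℝ} (h : c₁ * c₃ - c₂ ^ 2 ≠ 0)
    (hD : 0 < c₁ * c₃ - c₂ ^ 2) {γ : ℝ → AffPlus} {I : Set ℝ}
    (hγ : (stdMetric c₁ c₂ c₃ h).IsGeodesicOn γ I) :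
    ∃ δ, (stdMetric c₁ c₂ c₃ h).IsGeodesicOn δ univ ∧ EqOn δ γ I := by
  obtain ⟨hI, hI', ⟨t₀, ht₀⟩, hs, heq⟩ := hγ
  have h3 : c₃ ≠ 0 := by rintro rfl; nlinarith [sq_nonneg c₂]
  have hgeo (t : ℝ) (ht : t ∈ I) := (forall_christoffel_iff h (coord_pos (γ t))
    (fun i => deriv (fun s => coord (γ s) i) t)
    (fun k => deriv (deriv fun s => coord (γ s) k) t)).1 (heq t ht)
  have hd1 (k : Fin 2) (t : ℝ) (ht : t ∈ I) :
      HasDerivAt (fun s => coord (γ s) k) (deriv (fun s => coord (γ s) k) t) t :=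
    (((hs k).differentiableOn (by simp)).differentiableAt (hI.mem_nhds ht)).hasDerivAt
  have hd2 (k : Fin 2) (t : ℝ) (ht : t ∈ I) :
      HasDerivAt (deriv fun s => coord (γ s) k) (deriv (deriv fun s => coord (γ s) k) t) t :=
    ((((hs k).deriv_of_isOpen (m := 1) hI (by norm_cast)).differentiableOn
      (by simp)).differentiableAt (hI.mem_nhds ht)).hasDerivAt
  have hpos (t : ℝ) := coord_pos (γ t)
  obtain ⟨D, hDdef⟩ : ∃ D, D = c₁ * c₃ - c₂ ^ 2 := ⟨_, rfl⟩
  have hc₁ : c₁ = (D + c₂ ^ 2) / c₃ := by field_simp; linarith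
  have hD0 : 0 < D := hDdef ▸ hD
  obtain ⟨x, hx⟩ : ∃ x : ℝ → ℝ, x = fun t => coord (γ t) 0 := ⟨_, rfl⟩
  obtain ⟨y, hy⟩ : ∃ y : ℝ → ℝ, y = fun t => coord (γ t) 1 := ⟨_, rfl⟩
  have hx1 := hd1 0
  have hx2 := hd2 0
  have hy1 := hd1 1
  have hy2 := hd2 1
  have hxpos (t : ℝ) : 0 < x t := hx ▸ hpos t
  simp only [← hx, ← hy] at hx1 hx2 hy1 hy2 hgeo
  have hxt (t : ℝ) : coord (γ t) 0 = x t := by rw [hx]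
  simp only [GeodesicEq, ← hDdef, hxt] at hgeo
  -- `P` is the scalar product of the velocity with the Killing field `∂_y`.
  obtain ⟨P, hP⟩ : ∃ P, ∀ t ∈ I, (c₂ * deriv x t + c₃ * deriv y t) / x t ^ 2 = P := by
    refine exists_eq_of_hasDerivAt_zero hI hI' ⟨t₀, ht₀⟩ fun s hs => ?_
    have hne := (hxpos s).ne'
    refine ((((hx2 s hs).const_mul c₂).add ((hy2 s hs).const_mul c₃)).div ((hx1 s hs).pow 2)
      (pow_ne_zero 2 hne)).congr_deriv ?_
    obtain ⟨g1, g2⟩ := hgeo s hs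
    simp only [Nat.cast_ofNat, Nat.add_one_sub_one, pow_one, Pi.add_apply,
      Pi.pow_apply]
    field_simp
    linear_combination c₂ * g1 + c₃ * g2
  have hP' (t : ℝ) (ht : t ∈ I) : c₂ * deriv x t + c₃ * deriv y t = P * x t ^ 2 := by
    have hne := (hxpos t).ne'
    rw [← hP t ht]
    field_simp
  -- Eliminating `y'` through `P` decouples the equation for `x`.
  have hgeo' (t : ℝ) (ht : t ∈ I) :
      x t * deriv (deriv x) t = deriv x t ^ 2 - P ^ 2 * x t ^ 4 / D := by
    rw [(hgeo t ht).1, hc₁]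
    field_simp
    linear_combination (-(c₂ * deriv x t + c₃ * deriv y t) - P * x t ^ 2) * hP' t ht
  -- `E` is the energy `g(γ', γ')` times `c₃ / D`.
  obtain ⟨E, hE⟩ : ∃ E, ∀ t ∈ I, (deriv x t / x t) ^ 2 + P ^ 2 / D * x t ^ 2 = E := by
    refine exists_eq_of_hasDerivAt_zero hI hI' ⟨t₀, ht₀⟩ fun s hs => ?_
    have hne := (hxpos s).ne'
    refine ((((hx2 s hs).div (hx1 s hs) hne).pow 2).add
      (((hx1 s hs).pow 2).const_mul (P ^ 2 / D))).congr_deriv ?_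
    have g := hgeo' s hs
    simp only [Nat.cast_ofNat, Nat.add_one_sub_one, pow_one, Pi.div_apply]
    field_simp at g ⊢
    linear_combination 2 * deriv x s * g
  obtain ⟨U, V, hU, hU1, hU2, hUpos, hUV, hxU⟩ :=
    exists_extension_of_linear_ode hI hI' ⟨t₀, ht₀⟩ (u := fun t => 1 / x t)
      (v := fun t => -deriv x t / x t ^ 2) (E := E) (F := P ^ 2 / D)
      (fun t ht => by
        have hne := (hxpos t).ne'
        refine ((hasDerivAt_const t (1 : ℝ)).div (hx1 t ht) hne).congr_deriv ?_
        simp)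
      (fun t ht => by
        have hne := (hxpos t).ne'
        refine ((hx2 t ht).neg.div ((hx1 t ht).pow 2) (pow_ne_zero 2 hne)).congr_deriv ?_
        have g := hgeo' t ht
        rw [← hE t ht]
        simp only [Nat.cast_ofNat, Nat.add_one_sub_one, pow_one, Pi.pow_apply,
          Pi.neg_apply]
        field_simp at g ⊢
        linear_combination -g)
      (fun t _ => one_div_pos.2 (hxpos t)) (by positivity)
      (fun t ht => by
        have hne := (hxpos t).ne'
        rw [← hE t ht]
        field_simp
        ring)
  have hUne (t : ℝ) : U t ≠ 0 := (hUpos t).ne'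
  have hcont : Continuous fun t => P / U t ^ 2 :=
    continuous_const.div (hU.continuous.pow 2) fun t => pow_ne_zero 2 (hUne t)
  -- `Q` extends `c₂ x + c₃ y`, whose derivative is `P x ^ 2 = P / U ^ 2`; since `c₃ ≠ 0` it
  -- determines `y`.
  obtain ⟨Q, hQ, hQ0⟩ : ∃ Q : ℝ → ℝ, (∀ t, HasDerivAt Q (P / U t ^ 2) t) ∧
      Q t₀ = c₂ * x t₀ + c₃ * y t₀ :=
    ⟨fun t => (∫ s in t₀..t, P / U s ^ 2) + (c₂ * x t₀ + c₃ * y t₀),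
      fun t => (hcont.integral_hasStrictDerivAt t₀ t).hasDerivAt.add_const _, by simp⟩
  have hQs : ContDiff ℝ ∞ Q := by
    refine contDiff_infty_iff_deriv.2 ⟨fun t => (hQ t).differentiableAt, ?_⟩
    rw [show deriv Q = fun t => P / U t ^ 2 from funext fun t => (hQ t).deriv]
    exact contDiff_const.div (hU.pow 2) fun t => pow_ne_zero 2 (hUne t)
  have hxU' (t : ℝ) (ht : t ∈ I) : x t = 1 / U t := by
    rw [← hxU ht, one_div_one_div]
  have hQI (t : ℝ) (ht : t ∈ I) : c₂ * x t + c₃ * y t = Q t := by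
    have := eq_of_hasDerivAt_zero hI hI' (f := fun t => c₂ * x t + c₃ * y t - Q t)
      (fun s hs => by
        refine ((((hx1 s hs).const_mul c₂).add ((hy1 s hs).const_mul c₃)).sub (hQ s)).congr_deriv ?_
        rw [hP' s hs, hxU' s hs]
        have := hUne s
        field_simp
        ring) ht ht₀
    simp only [hQ0, sub_self] at this
    linarith
  have hUinv : ContDiff ℝ ∞ fun t => 1 / U t := contDiff_const.div hU hUne
  refine ⟨fun t => pt ![1 / U t, (Q t - c₂ * (1 / U t)) / c₃],
    isGeodesicOn_of_hasDerivAt h isOpen_univ ordConnected_univ univ_nonempty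
      (x' := fun t => -V t / U t ^ 2)
      (x'' := fun t => -E / U t + 2 * V t ^ 2 / U t ^ 3)
      (y' := fun t => (P / U t ^ 2 + c₂ * (V t / U t ^ 2)) / c₃)
      (y'' := fun t => (-2 * P * V t / U t ^ 3 + c₂ * (E / U t - 2 * V t ^ 2 / U t ^ 3)) / c₃)
      hUinv.contDiffOn
      ((hQs.sub (contDiff_const.mul hUinv)).div_const c₃).contDiffOn
      (fun t _ => one_div_pos.2 (hUpos t)) (fun t _ => ?_) (fun t _ => ?_) (fun t _ => ?_)
      (fun t _ => ?_) (fun t _ => ?_), fun t ht => ?_⟩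
  · refine ((hasDerivAt_const t (1 : ℝ)).div (hU1 t) (hUne t)).congr_deriv ?_
    simp
  · refine ((hU2 t).neg.div ((hU1 t).pow 2) (pow_ne_zero 2 (hUne t))).congr_deriv ?_
    have := hUne t
    simp
    field_simp
  · refine (((hQ t).sub (((hasDerivAt_const t (1 : ℝ)).div (hU1 t) (hUne t)).const_mul
      c₂)).div_const c₃).congr_deriv ?_
    have := hUne t
    field_simp
    ring
  · refine ((((hasDerivAt_const t P).div ((hU1 t).pow 2) (pow_ne_zero 2 (hUne t))).add
      (((hU2 t).div ((hU1 t).pow 2) (pow_ne_zero 2 (hUne t))).const_mul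
        c₂)).div_const c₃).congr_deriv ?_
    have := hUne t
    simp
    field_simp
  · have := hUne t
    have hV := hUV t
    have hE' : E = (V t ^ 2 + P ^ 2 / D) / U t ^ 2 := by field_simp at hV ⊢; linarith
    rw [GeodesicEq, ← hDdef, hE', hc₁]
    constructor
    · field_simp
      ring
    · field_simp
      ring
  · apply coord_injective
    have : 0 < (![1 / U t, (Q t - c₂ * (1 / U t)) / c₃] : Fin 2 → ℝ) 0 := one_div_pos.2 (hUpos t)
    simp only [coord_pt this]
    ext k
    fin_cases k
    · exact (hxU' t ht).symm.trans (hxt t).symm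
    · change (Q t - c₂ * (1 / U t)) / c₃ = coord (γ t) 1
      rw [← hxU' t ht, ← hQI t ht, hy]
      field_simp
      ring

theorem isComplete_of_disc_pos {c₁ c₂ c₃ : ℝ} (h : c₁ * c₃ - c₂ ^ 2 ≠ 0)
    (hD : 0 < c₁ * c₃ - c₂ ^ 2) : (stdMetric c₁ c₂ c₃ h).IsComplete := by
  rintro γ I ⟨hγ, hmax⟩
  obtain ⟨δ, hδ, heq⟩ := exists_geodesic_extension h hD hγ
  exact (hmax δ univ hδ (subset_univ I) heq).symm

end AffLine

end

theorem corollary1p2 :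
    -- completeness is equivalent to definiteness
    (∀ g : AffLine.SemiRiemannianMetric, g.IsLeftInvariant → (g.IsComplete ↔ g.IsDefinite)) ∧
    -- every Lorentzian left-invariant metric lies in exactly one of two classes
    {b | ∃ g : AffLine.SemiRiemannianMetric, g.IsLeftInvariant ∧ g.IsLorentzian ∧
        g.atOne (AffLine.e 1) (AffLine.e 1) ≠ 0 ∧ g.atOne = b} =
      AffLine.scaledAutOrbit AffLine.gMinus.atOne ∧
    {b | ∃ g : AffLine.SemiRiemannianMetric, g.IsLeftInvariant ∧ g.IsLorentzian ∧
        g.atOne (AffLine.e 1) (AffLine.e 1) = 0 ∧ g.atOne = b} =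
      AffLine.autOrbit AffLine.gZero.atOne ∧
    -- each class contains an explicit metric with an explicit incomplete geodesic
    (AffLine.gMinus.IsLeftInvariant ∧ AffLine.gMinus.IsLorentzian ∧
      AffLine.gMinus.IsMaximalGeodesicOn
        (fun t => AffLine.pt ![1 / (1 - t), 1 / (1 - t)]) (Set.Iio 1) ∧
      ¬ AffLine.gMinus.IsComplete) ∧
    (AffLine.gZero.IsLeftInvariant ∧ AffLine.gZero.IsLorentzian ∧
      AffLine.gZero.IsMaximalGeodesicOn
        (fun t => AffLine.pt ![1 / (1 - t), 0]) (Set.Iio 1) ∧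
      ¬ AffLine.gZero.IsComplete) := by
  open AffLine in
  refine ⟨fun g hg => ?_, setOf_lorentzian_eq_scaledAutOrbit, setOf_lorentzian_eq_autOrbit,
    ⟨stdMetric_isLeftInvariant _, (stdMetric_isLorentzian_iff _).2 (by norm_num),
      isMaximalGeodesicOn_null _ (by norm_num), not_isComplete_of_disc_neg _ (by norm_num)⟩,
    ⟨stdMetric_isLeftInvariant _, (stdMetric_isLorentzian_iff _).2 (by norm_num), ?_,
      not_isComplete_of_disc_neg _ (by norm_num)⟩⟩
  · obtain ⟨c₁, c₂, c₃, h, rfl⟩ := hg.exists_eq_stdMetric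
    rw [stdMetric_isDefinite_iff]
    refine ⟨fun hc => ?_, isComplete_of_disc_pos h⟩
    by_contra hD
    exact not_isComplete_of_disc_neg h (lt_of_le_of_ne (not_lt.1 hD) h) hc
  · have := isMaximalGeodesicOn_null (c₁ := 0) (c₂ := 1) (c₃ := 0) (m := 0)
      (by norm_num) (by norm_num)
    simp only [zero_div] at this
    exact this
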